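/- Let $\widetilde\ell$ be the free (non-commutative) monoid generated by symbols $z_1,z_2,z_3,\dots$, and for a word $\alpha=z_{i_1}z_{i_2}\cdots z_{i_m}\in\widetilde\ell$ put $(2\mathbb N)^{\alpha}=\prod_{j=1}^m 2i_j$ (equal to $1$ for the empty word). For $p\in\mathbb Z$ let $\mathbf L^2(\widetilde\ell,\widetilde\mu_p)$ be the Hilbert space of families $f=(f_\alpha)_{\alpha\in\widetilde\ell}$ of complex numbers with $\|f\|_{\widetilde\mu_p}^2=\sum_{\alpha}|f_\alpha|^2(2\mathbb N)^{\alpha p}<\infty$. Let $$\widetilde{\mathcal S}_1=\bigcap_{p\in\mathbb N}\mathbf L^2(\widetilde\ell,\widetilde\mu_p),\qquad \widetilde{\mathcal S}_{-1}=\bigcup_{p\in\mathbb N}\mathbf L^2(\widetilde\ell,\widetilde\mu_{-p}),$$ where $\widetilde{\mathcal S}_1$ carries the topology generated by the norms $\|\cdot\|_{\widetilde\mu_p}$, $p\in\mathbb N$, and $\widetilde{\mathcal S}_{-1}$ is identified with the dual of $\widetilde{\mathcal S}_1$ through the pairing $\langle f,\varphi\rangle=\sum_\alpha f_\alpha\varphi_\alpha$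 and carries the strong dual topology (uniform convergence on bounded subsets of $\widetilde{\mathcal S}_1$). The non-commutative Wick product of $f,g\in\widetilde{\mathcal S}_{-1}$ is $$f\otimes g=\Big(\sum_{\beta\gamma=\alpha}f_\beta\, g_\gamma\Big)_{\alpha\in\widetilde\ell}\in\widetilde{\mathcal S}_{-1}.$$ **Theorem.** The Wick product $(f,g)\mapsto f\otimes g$ is a (jointly) continuous function $\widetilde{\mathcal S}_{-1}\times\widetilde{\mathcal S}_{-1}\to\widetilde{\mathcal S}_{-1}$ in the strong topology. Hence $(\widetilde{\mathcal S}_{-1},+,\otimes)$ is a topological $\mathbb C$-algebra: it is an associative $\mathbb C$-algebra (with unit the family equal to $1$ at the empty word and $0$ elsewhere) whose addition, negation, multiplication and scalar multiplication $\mathbb C\times\widetilde{\mathcal S}_{-1}\to\widetilde{\mathcal S}_{-1}$ are continuous. -/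

import Mathlib

noncomputable section

namespace NCKondratiev

/-- The free non-commutative monoid generated by the positive integers: finite words
`z_{i₁} z_{i₂} ⋯ z_{iₘ}` with `iⱼ ≥ 1`, multiplied by concatenation. -/
abbrev Word : Type := FreeMonoid ℕ+

instance : DecidableEq Word := inferInstanceAs (DecidableEq (List ℕ+))

/-- `(2ℕ)^α = ∏ⱼ 2 iⱼ` for the word `α = z_{i₁} ⋯ z_{iₘ}`. -/
def weight : Word →* ℝ := FreeMonoid.lift fun i : ℕ+ => 2 * ((i : ℕ) : ℝ)

theorem one_le_weight (α : Word) : 1 ≤ weight α := by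
  induction α using FreeMonoid.inductionOn' with
  | one => simp
  | of_mul i α ih =>
    have hi : (1 : ℝ) ≤ ((i : ℕ) : ℝ) := by exact_mod_cast i.pos
    have h : weight (FreeMonoid.of i) = 2 * ((i : ℕ) : ℝ) := by simp [weight]
    rw [map_mul, h]
    nlinarith

theorem weight_pos (α : Word) : 0 < weight α := zero_lt_one.trans_le (one_le_weight α)

/-- `‖f‖² = ∑_α |f_α|² (2ℕ)^{α p}` is finite, for a family of coefficients `f`. -/
def IsL2 (p : ℤ) (f : Word → ℂ) : Prop := Summable fun α => ‖f α‖ ^ 2 * weight α ^ p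

/-- The norm of the weighted space `L²(μ_p)`, where `μ_p(α) = (2ℕ)^{α p}`. -/
def l2norm (p : ℤ) (f : Word → ℂ) : ℝ := √(∑' α, ‖f α‖ ^ 2 * weight α ^ p)

theorem term_nonneg (p : ℤ) (f : Word → ℂ) (α : Word) : 0 ≤ ‖f α‖ ^ 2 * weight α ^ p :=
  mul_nonneg (sq_nonneg _) (zpow_nonneg (weight_pos α).le p)

theorem l2norm_nonneg (p : ℤ) (f : Word → ℂ) : 0 ≤ l2norm p f := Real.sqrt_nonneg _

theorem sqrt_zpow_sq (p : ℤ) (α : Word) : (√(weight α) ^ p) ^ 2 = weight α ^ p := by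
  rw [← zpow_natCast, ← zpow_mul, mul_comm, zpow_mul, zpow_natCast,
    Real.sq_sqrt (weight_pos α).le]

theorem term_eq (p : ℤ) (f : Word → ℂ) (α : Word) :
    ‖f α‖ ^ 2 * weight α ^ p = (‖f α‖ * √(weight α) ^ p) ^ (2 : ℝ) := by
  rw [Real.rpow_two, mul_pow, sqrt_zpow_sq]

theorem scaled_nonneg (p : ℤ) (f : Word → ℂ) (α : Word) : 0 ≤ ‖f α‖ * √(weight α) ^ p :=
  mul_nonneg (norm_nonneg _) (zpow_nonneg (Real.sqrt_nonneg _) _)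

theorem l2norm_eq (p : ℤ) (f : Word → ℂ) :
    l2norm p f = (∑' α, (‖f α‖ * √(weight α) ^ p) ^ (2 : ℝ)) ^ (1 / (2 : ℝ)) := by
  rw [l2norm, Real.sqrt_eq_rpow]
  simp only [term_eq]

theorem add_aux {p : ℤ} {f g : Word → ℂ} (hf : IsL2 p f) (hg : IsL2 p g) :
    IsL2 p (f + g) ∧ l2norm p (f + g) ≤ l2norm p f + l2norm p g := by
  have hf' : Summable fun α => (‖f α‖ * √(weight α) ^ p) ^ (2 : ℝ) := by
    simpa only [IsL2, term_eq] using hf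
  have hg' : Summable fun α => (‖g α‖ * √(weight α) ^ p) ^ (2 : ℝ) := by
    simpa only [IsL2, term_eq] using hg
  obtain ⟨h1, h2⟩ := Real.Lp_add_le_tsum_of_nonneg one_le_two (scaled_nonneg p f)
    (scaled_nonneg p g) hf' hg'
  have hle : ∀ α, (‖(f + g) α‖ * √(weight α) ^ p) ^ (2 : ℝ) ≤
      (‖f α‖ * √(weight α) ^ p + ‖g α‖ * √(weight α) ^ p) ^ (2 : ℝ) := fun α => by
    refine Real.rpow_le_rpow (scaled_nonneg p _ α) ?_ zero_le_two
    rw [← add_mul]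
    exact mul_le_mul_of_nonneg_right (norm_add_le _ _) (zpow_nonneg (Real.sqrt_nonneg _) _)
  have hs : Summable fun α => (‖(f + g) α‖ * √(weight α) ^ p) ^ (2 : ℝ) :=
    Summable.of_nonneg_of_le (fun α => Real.rpow_nonneg (scaled_nonneg p _ α) _) hle h1
  refine ⟨by simpa only [IsL2, term_eq] using hs, ?_⟩
  simp only [l2norm_eq]
  refine le_trans (Real.rpow_le_rpow (tsum_nonneg fun α =>
    Real.rpow_nonneg (scaled_nonneg p _ α) _) (hs.tsum_le_tsum hle h1) (by norm_num)) h2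

theorem smul_aux (p : ℤ) (c : ℂ) (f : Word → ℂ) (α : Word) :
    ‖(c • f) α‖ ^ 2 * weight α ^ p = ‖c‖ ^ 2 * (‖f α‖ ^ 2 * weight α ^ p) := by
  simp [mul_pow, mul_assoc]

/-- The weighted space `L²(μ_p)` as a space of families of coefficients. -/
def L2 (p : ℤ) : Submodule ℂ (Word → ℂ) where
  carrier := {f | IsL2 p f}
  add_mem' hf hg := (add_aux hf hg).1
  zero_mem' := by simp [IsL2, summable_zero]
  smul_mem' c f hf := by
    simp only [Set.mem_ofPred_eq, IsL2, smul_aux] at hf ⊢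
    exact hf.mul_left _

theorem mem_L2 {p : ℤ} {f : Word → ℂ} : f ∈ L2 p ↔ IsL2 p f := Iff.rfl

theorem term_mono {p q : ℤ} (h : p ≤ q) (f : Word → ℂ) (α : Word) :
    ‖f α‖ ^ 2 * weight α ^ p ≤ ‖f α‖ ^ 2 * weight α ^ q :=
  mul_le_mul_of_nonneg_left (zpow_le_zpow_right₀ (one_le_weight α) h) (sq_nonneg _)

theorem IsL2.mono {p q : ℤ} (h : p ≤ q) {f : Word → ℂ} (hf : IsL2 q f) : IsL2 p f :=
  Summable.of_nonneg_of_le (term_nonneg p f) (term_mono h f) hf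

theorem l2norm_mono {p q : ℤ} (h : p ≤ q) {f : Word → ℂ} (hf : IsL2 q f) :
    l2norm p f ≤ l2norm q f :=
  Real.sqrt_le_sqrt ((hf.mono h).tsum_le_tsum (term_mono h f) hf)

/-! ### The space of test functions -/

/-- The non-commutative Kondratiev space of stochastic test functions, `⋂_p L²(μ_p)`. -/
def TestSpace : Type := ↥(⨅ p : ℕ, L2 (p : ℤ))

instance : AddCommGroup TestSpace := inferInstanceAs (AddCommGroup ↥(⨅ p : ℕ, L2 (p : ℤ)))

instance : Module ℂ TestSpace := inferInstanceAs (Module ℂ ↥(⨅ p : ℕ, L2 (p : ℤ)))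

/-- The family of coefficients of a test function. -/
def TestSpace.coeff : TestSpace →ₗ[ℂ] (Word → ℂ) := (⨅ p : ℕ, L2 (p : ℤ)).subtype

theorem TestSpace.isL2 (φ : TestSpace) (p : ℕ) : IsL2 p φ.coeff :=
  (Submodule.mem_iInf _).1 φ.2 p

theorem TestSpace.coeff_injective : Function.Injective TestSpace.coeff := Subtype.val_injective

/-- The Hilbert norm `‖·‖_p` of `L²(μ_p)` on the space of test functions. -/
def testSeminorm (p : ℕ) : Seminorm ℂ TestSpace :=
  Seminorm.of (fun φ => l2norm p φ.coeff)
    (fun φ ψ => by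
      rw [map_add]
      exact (add_aux (φ.isL2 p) (ψ.isL2 p)).2)
    (fun c φ => by
      simp only [map_smul, l2norm, smul_aux]
      rw [tsum_mul_left, Real.sqrt_mul (sq_nonneg _), Real.sqrt_sq (norm_nonneg _)])

theorem testSeminorm_apply (p : ℕ) (φ : TestSpace) : testSeminorm p φ = l2norm p φ.coeff := rfl

/-- The countably Hilbert topology: it is generated by the norms `‖·‖_p`, `p ∈ ℕ`. -/
instance : TopologicalSpace TestSpace :=
  (SeminormFamily.moduleFilterBasis (𝕜 := ℂ) (fun p : ℕ => testSeminorm p)).topology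

theorem withSeminorms_test : WithSeminorms (𝕜 := ℂ) (fun p : ℕ => testSeminorm p) := ⟨rfl⟩

instance : IsTopologicalAddGroup TestSpace := withSeminorms_test.topologicalAddGroup

instance : ContinuousSMul ℂ TestSpace := withSeminorms_test.continuousSMul

/-! ### The space of distributions -/

/-- The families of coefficients lying in `⋃_p L²(μ_{-p})`. -/
def distSubmodule : Submodule ℂ (Word → ℂ) where
  carrier := {f | ∃ p : ℕ, f ∈ L2 (-(p : ℤ))}
  add_mem' := by
    rintro f g ⟨p, hf⟩ ⟨q, hg⟩
    refine ⟨max p q, (L2 _).add_mem (IsL2.mono ?_ hf) (IsL2.mono ?_ hg)⟩ <;> simp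
  zero_mem' := ⟨0, (L2 _).zero_mem⟩
  smul_mem' := by
    rintro c f ⟨p, hf⟩
    exact ⟨p, (L2 _).smul_mem c hf⟩

/-- The non-commutative Kondratiev space of stochastic distributions, `⋃_p L²(μ_{-p})`. -/
def DistSpace : Type := ↥distSubmodule

instance : AddCommGroup DistSpace := inferInstanceAs (AddCommGroup ↥distSubmodule)

instance : Module ℂ DistSpace := inferInstanceAs (Module ℂ ↥distSubmodule)

/-- The family of coefficients of a distribution. -/
def DistSpace.coeff : DistSpace →ₗ[ℂ] (Word → ℂ) := distSubmodule.subtype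

theorem DistSpace.isL2 (f : DistSpace) : ∃ p : ℕ, IsL2 (-(p : ℤ)) f.coeff := f.2

theorem DistSpace.coeff_injective : Function.Injective DistSpace.coeff := Subtype.val_injective

/-- Cauchy-Schwarz for the duality between `L²(μ_{-p})` and `L²(μ_p)`. -/
theorem pairing_aux {p : ℤ} {f φ : Word → ℂ} (hf : IsL2 (-p) f) (hφ : IsL2 p φ) :
    (Summable fun α => f α * φ α) ∧ ‖∑' α, f α * φ α‖ ≤ l2norm (-p) f * l2norm p φ := by
  have hf' : Summable fun α => (‖f α‖ * √(weight α) ^ (-p)) ^ (2 : ℝ) := by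
    simpa only [IsL2, term_eq] using hf
  have hφ' : Summable fun α => (‖φ α‖ * √(weight α) ^ p) ^ (2 : ℝ) := by
    simpa only [IsL2, term_eq] using hφ
  obtain ⟨h1, h2⟩ := Real.summable_and_inner_le_Lp_mul_Lq_tsum_of_nonneg Real.HolderConjugate.two_two
    (scaled_nonneg (-p) f) (scaled_nonneg p φ) hf' hφ'
  have he : ∀ α, ‖f α‖ * √(weight α) ^ (-p) * (‖φ α‖ * √(weight α) ^ p) = ‖f α * φ α‖ :=
    fun α => by
      have h0 : √(weight α) ^ p ≠ 0 := zpow_ne_zero _ (Real.sqrt_pos.2 (weight_pos α)).ne'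
      rw [zpow_neg, norm_mul]
      field_simp
  simp only [he, ← l2norm_eq] at h1 h2
  exact ⟨h1.of_norm, (norm_tsum_le_tsum_norm h1).trans h2⟩

/-- The linear functional `φ ↦ ∑_α f_α φ_α` on test functions given by a distribution `f`. -/
def pairing (f : DistSpace) : TestSpace →ₗ[ℂ] ℂ where
  toFun φ := ∑' α, f.coeff α * φ.coeff α
  map_add' φ ψ := by
    obtain ⟨p, hp⟩ := f.isL2
    simp only [map_add, Pi.add_apply, mul_add]
    exact (pairing_aux hp (φ.isL2 p)).1.tsum_add (pairing_aux hp (ψ.isL2 p)).1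
  map_smul' c φ := by
    simp only [map_smul, Pi.smul_apply, smul_eq_mul, RingHom.id_apply, ← tsum_mul_left]
    exact tsum_congr fun α => by ring

theorem pairing_continuous (f : DistSpace) : Continuous (pairing f) := by
  obtain ⟨p, hp⟩ := f.isL2
  refine WithSeminorms.continuous_normedSpace_rng ℂ withSeminorms_test (pairing f)
    ⟨{p}, ⟨l2norm (-p) f.coeff, l2norm_nonneg _ _⟩, fun φ => ?_⟩
  rw [Finset.sup_singleton]
  exact (pairing_aux hp (φ.isL2 p)).2

/-- The map sending a distribution `f` to the continuous linear functional `φ ↦ ∑_α f_α φ_α`. -/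
def toDual : DistSpace →ₗ[ℂ] StrongDual ℂ TestSpace where
  toFun f := ⟨pairing f, pairing_continuous f⟩
  map_add' f g := by
    ext φ
    obtain ⟨p, hp⟩ := f.isL2
    obtain ⟨q, hq⟩ := g.isL2
    change ∑' α, (f + g).coeff α * φ.coeff α =
      ∑' α, f.coeff α * φ.coeff α + ∑' α, g.coeff α * φ.coeff α
    simp only [map_add, Pi.add_apply, add_mul]
    exact (pairing_aux hp (φ.isL2 p)).1.tsum_add (pairing_aux hq (φ.isL2 q)).1
  map_smul' c f := by
    ext φ
    change ∑' α, (c • f).coeff α * φ.coeff α = c * ∑' α, f.coeff α * φ.coeff α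
    simp only [map_smul, Pi.smul_apply, smul_eq_mul, ← tsum_mul_left, mul_assoc]

theorem toDual_apply (f : DistSpace) (φ : TestSpace) :
    toDual f φ = ∑' α, f.coeff α * φ.coeff α := rfl

/-- The test function `∑_{α ∈ s} c_α e_α`, for a finite set `s` of words. -/
def finTest (s : Finset Word) (c : Word → ℂ) : TestSpace :=
  ⟨fun α => if α ∈ s then c α else 0, (Submodule.mem_iInf _).2 fun p =>
    summable_of_ne_finset_zero (s := s) fun α hα => by simp [hα]⟩

theorem finTest_coeff (s : Finset Word) (c : Word → ℂ) (α : Word) :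
    (finTest s c).coeff α = if α ∈ s then c α else 0 := rfl

theorem finTest_eq_sum (s : Finset Word) (c : Word → ℂ) :
    finTest s c = ∑ α ∈ s, c α • finTest {α} 1 := by
  apply TestSpace.coeff_injective
  ext β
  simp [map_sum, finTest_coeff, Finset.sum_apply]

theorem toDual_injective : Function.Injective toDual := by
  intro f g h
  apply DistSpace.coeff_injective
  ext α
  have h1 := DFunLike.congr_fun h (finTest {α} 1)
  simp only [toDual_apply, finTest_coeff] at h1
  rw [tsum_eq_single α (by intro β hβ; simp [hβ]), tsum_eq_single α (by intro β hβ; simp [hβ])]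
    at h1
  simpa using h1

theorem l2norm_finTest (p : ℤ) (s : Finset Word) (c : Word → ℂ) :
    l2norm p (finTest s c).coeff = √(∑ α ∈ s, ‖c α‖ ^ 2 * weight α ^ p) := by
  rw [l2norm, tsum_eq_sum (s := s) (fun α hα => by simp [finTest_coeff, hα])]
  congr 1
  exact Finset.sum_congr rfl fun α hα => by simp [finTest_coeff, hα]

theorem finTest_tendsto (φ : TestSpace) :
    Filter.Tendsto (fun s : Finset Word => finTest s φ.coeff) Filter.atTop (nhds φ) := by
  rw [withSeminorms_test.tendsto_nhds]
  intro p ε hε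
  have h := tendsto_tsum_compl_atTop_zero fun α => ‖φ.coeff α‖ ^ 2 * weight α ^ (p : ℤ)
  filter_upwards [h.eventually (gt_mem_nhds (pow_pos hε 2))] with s hs
  rw [testSeminorm_apply, l2norm, Real.sqrt_lt' hε]
  refine lt_of_eq_of_lt ?_ hs
  refine Eq.trans ?_
    (tsum_subtype {a | a ∉ s} (fun α => ‖φ.coeff α‖ ^ 2 * weight α ^ (p : ℤ))).symm
  refine tsum_congr fun α => ?_
  by_cases hα : α ∈ s <;> simp [finTest_coeff, hα]

theorem dual_bound (L : StrongDual ℂ TestSpace) :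
    ∃ (p : ℕ) (C : ℝ), 0 ≤ C ∧ ∀ φ, ‖L φ‖ ≤ C * l2norm p φ.coeff := by
  obtain ⟨s, C, -, hC⟩ := Seminorm.bound_of_continuous withSeminorms_test
    ((normSeminorm ℂ ℂ).comp (L : TestSpace →ₗ[ℂ] ℂ)) L.continuous.norm
  refine ⟨s.sup id, C, C.2, fun φ => (hC φ).trans ?_⟩
  have h : s.sup (fun p : ℕ => testSeminorm p) ≤ testSeminorm (s.sup id) :=
    Finset.sup_le fun i hi φ => l2norm_mono
      (by exact_mod_cast Finset.le_sup (f := id) hi) (φ.isL2 _)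
  exact mul_le_mul_of_nonneg_left (h φ) C.2

theorem toDual_surjective : Function.Surjective toDual := by
  intro L
  obtain ⟨p, C, hC0, hC⟩ := dual_bound L
  set f : Word → ℂ := fun α => L (finTest {α} 1) with hf
  have hL : ∀ s c, L (finTest s c) = ∑ α ∈ s, c α * f α := fun s c => by
    rw [finTest_eq_sum, map_sum]
    simp [hf]
  have hsum : IsL2 (-(p : ℤ)) f := by
    refine summable_of_sum_le (c := C ^ 2) (term_nonneg _ f) fun s => ?_
    set A : ℝ := ∑ α ∈ s, ‖f α‖ ^ 2 * weight α ^ (-(p : ℤ)) with hA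
    have hA0 : 0 ≤ A := Finset.sum_nonneg fun α _ => term_nonneg _ f α
    have h := hC (finTest s fun α => (starRingEnd ℂ) (f α) * ((weight α ^ (-(p : ℤ)) : ℝ) : ℂ))
    have h1 : L (finTest s fun α => (starRingEnd ℂ) (f α) * ((weight α ^ (-(p : ℤ)) : ℝ) : ℂ))
        = (A : ℂ) := by
      rw [hL, hA, Complex.ofReal_sum]
      refine Finset.sum_congr rfl fun α _ => ?_
      rw [Complex.ofReal_mul, Complex.ofReal_pow, ← Complex.conj_mul']
      ring
    have h2 : ∑ α ∈ s, ‖(starRingEnd ℂ) (f α) * ((weight α ^ (-(p : ℤ)) : ℝ) : ℂ)‖ ^ 2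
        * weight α ^ (p : ℤ) = A := by
      refine Finset.sum_congr rfl fun α _ => ?_
      have hw := (zpow_pos (weight_pos α) (p : ℤ)).ne'
      rw [norm_mul, RCLike.norm_conj, Complex.norm_real, Real.norm_eq_abs, mul_pow, sq_abs,
        zpow_neg]
      field_simp
    rw [h1, l2norm_finTest, h2, Complex.norm_real, Real.norm_eq_abs, abs_of_nonneg hA0] at h
    have h3 := Real.sq_sqrt hA0
    have h4 := Real.sqrt_nonneg A
    rcases h4.eq_or_lt with h5 | h5
    · rw [← h3, ← h5]
      nlinarith
    · have : √A ≤ C := by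
        by_contra! hlt
        nlinarith
      nlinarith
  refine ⟨⟨f, p, hsum⟩, ?_⟩
  ext φ
  have ht := (L.continuous.tendsto φ).comp (finTest_tendsto φ)
  have hs := (pairing_aux hsum (φ.isL2 p)).1.hasSum
  refine tendsto_nhds_unique hs (ht.congr fun s => ?_)
  rw [Function.comp, hL]
  exact Finset.sum_congr rfl fun α _ => mul_comm _ _

/-- `⋃_p L²(μ_{-p})` is the dual of the space of test functions. -/
def dualEquiv : DistSpace ≃ₗ[ℂ] StrongDual ℂ TestSpace :=
  LinearEquiv.ofBijective toDual ⟨toDual_injective, toDual_surjective⟩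

theorem dualEquiv_apply (f : DistSpace) (φ : TestSpace) :
    dualEquiv f φ = ∑' α, f.coeff α * φ.coeff α := rfl

/-- The strong topology: distributions carry the topology of the strong dual of the space of test
functions (uniform convergence on bounded sets of test functions), through `dualEquiv`. -/
instance : TopologicalSpace DistSpace := TopologicalSpace.induced dualEquiv inferInstance

/-! ### The Wick product -/

/-- A word has finitely many factorizations `α = β γ`. -/
instance : Finset.HasMulAntidiagonal Word where
  mulAntidiagonal α := (Finset.range (α.toList.length + 1)).image fun k =>
    (FreeMonoid.ofList (α.toList.take k), FreeMonoid.ofList (α.toList.drop k))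
  mem_mulAntidiagonal := by
    rintro α ⟨β, γ⟩
    simp only [Finset.mem_image, Finset.mem_range, Prod.mk.injEq]
    constructor
    · rintro ⟨k, -, rfl, rfl⟩
      rw [← FreeMonoid.ofList_append, List.take_append_drop, FreeMonoid.ofList_toList]
    · rintro rfl
      exact ⟨β.toList.length, by simp, by simp, by simp⟩

/-- The Wick product of families of coefficients: the convolution over the monoid of words,
`(f ⊗ g)_α = ∑_{β γ = α} f_β g_γ`. -/
def conv (f g : Word → ℂ) (α : Word) : ℂ :=
  ∑ x ∈ Finset.HasMulAntidiagonal.mulAntidiagonal α, f x.1 * g x.2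

theorem conv_assoc (f g h : Word → ℂ) : conv (conv f g) h = conv f (conv g h) := by
  ext α
  simp only [conv, Finset.sum_mul, Finset.mul_sum]
  rw [Finset.sum_sigma', Finset.sum_sigma']
  refine Finset.sum_nbij' (fun x => ⟨(x.2.1, x.2.2 * x.1.2), (x.2.2, x.1.2)⟩)
    (fun x => ⟨(x.1.1 * x.2.1, x.2.2), (x.1.1, x.2.1)⟩) ?_ ?_ ?_ ?_ ?_
  all_goals
    rintro ⟨⟨a, b⟩, ⟨c, d⟩⟩ hx
    simp only [Finset.mem_sigma, Finset.HasMulAntidiagonal.mem_mulAntidiagonal] at hx ⊢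
    obtain ⟨rfl, rfl⟩ := hx
    simp [mul_assoc]

theorem conv_add (f g h : Word → ℂ) : conv f (g + h) = conv f g + conv f h := by
  ext α
  simp [conv, mul_add, Finset.sum_add_distrib]

theorem add_conv (f g h : Word → ℂ) : conv (f + g) h = conv f h + conv g h := by
  ext α
  simp [conv, add_mul, Finset.sum_add_distrib]

theorem smul_conv (c : ℂ) (f g : Word → ℂ) : conv (c • f) g = c • conv f g := by
  ext α
  simp [conv, Finset.mul_sum, mul_assoc]

theorem conv_smul (c : ℂ) (f g : Word → ℂ) : conv f (c • g) = c • conv f g := by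
  ext α
  simp [conv, Finset.mul_sum, mul_left_comm]

/-- The coefficients of the vacuum vector. -/
def vacuum : Word → ℂ := fun α => if α = 1 then 1 else 0

theorem vacuum_conv (f : Word → ℂ) : conv vacuum f = f := by
  ext α
  rw [conv, Finset.sum_eq_single (1, α)]
  · simp [vacuum]
  · rintro ⟨b, c⟩ hx hne
    have hb : b ≠ 1 := by
      rintro rfl
      simp_all
    simp [vacuum, hb]
  · simp

theorem conv_vacuum (f : Word → ℂ) : conv f vacuum = f := by
  ext α
  rw [conv, Finset.sum_eq_single (α, 1)]
  · simp [vacuum]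
  · rintro ⟨b, c⟩ hx hne
    have hc : c ≠ 1 := by
      rintro rfl
      simp_all
    simp [vacuum, hc]
  · simp

theorem vacuum_mem : vacuum ∈ distSubmodule :=
  ⟨0, summable_of_ne_finset_zero (s := {1}) fun α hα => by
    have : α ≠ 1 := by simpa using hα
    simp [vacuum, this]⟩

/-- `∑_i (2i)^{-2} < 1`, the sum being over the positive integers. -/
theorem letters_sum_lt_one :
    ∑' i : ℕ+, ENNReal.ofReal ((2 * ((i : ℕ) : ℝ)) ^ (-2 : ℤ)) < 1 := by
  have h0 : HasSum (fun n : ℕ => (2 * (n : ℝ)) ^ (-2 : ℤ)) (Real.pi ^ 2 / 24) := by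
    have h := hasSum_zeta_two.mul_left (1 / 4)
    have he : (fun n : ℕ => (1 / 4 : ℝ) * (1 / (n : ℝ) ^ 2)) =
        fun n : ℕ => (2 * (n : ℝ)) ^ (-2 : ℤ) := by
      ext n
      rw [zpow_neg, show (2 : ℤ) = ((2 : ℕ) : ℤ) from rfl, zpow_natCast, mul_pow, mul_inv]
      norm_num
    rw [he] at h
    rwa [show (1 / 4 : ℝ) * (Real.pi ^ 2 / 6) = Real.pi ^ 2 / 24 by ring] at h
  have h1 : Real.pi ^ 2 / 24 < 1 := by
    have := Real.pi_lt_four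
    have := Real.pi_pos
    nlinarith
  refine lt_of_le_of_lt
    (ENNReal.tsum_comp_le_tsum_of_injective PNat.coe_injective
      (fun n : ℕ => ENNReal.ofReal ((2 * (n : ℝ)) ^ (-2 : ℤ)))) ?_
  rw [← ENNReal.ofReal_tsum_of_nonneg (fun n => by positivity) h0.summable, h0.tsum_eq]
  exact ENNReal.ofReal_lt_one.2 h1

theorem tsum_fin_prod (a : ℕ+ → ENNReal) (n : ℕ) :
    ∑' v : Fin n → ℕ+, ∏ i, a (v i) = (∑' i, a i) ^ n := by
  induction n with
  | zero => simp [tsum_fintype]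
  | succ n ih =>
    rw [← (Fin.consEquiv fun _ : Fin (n + 1) => ℕ+).tsum_eq,
      ENNReal.tsum_prod (f := fun i v => ∏ k, a ((Fin.consEquiv fun _ => ℕ+) (i, v) k)),
      pow_succ', ← ih, ← ENNReal.tsum_mul_right]
    refine tsum_congr fun i => ?_
    rw [← ENNReal.tsum_mul_left]
    refine tsum_congr fun v => ?_
    simp [Fin.consEquiv, Fin.prod_univ_succ]

theorem weight_ofFn (n : ℕ) (v : Fin n → ℕ+) :
    weight (FreeMonoid.ofList (List.ofFn v)) = ∏ i, 2 * (((v i : ℕ+) : ℕ) : ℝ) := by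
  rw [weight, FreeMonoid.lift_apply, FreeMonoid.toList_ofList, List.map_ofFn, List.prod_ofFn]
  rfl

/-- `∑_α (2ℕ)^{-2α} < ∞`. -/
theorem summable_weight : Summable fun α : Word => weight α ^ (-2 : ℤ) := by
  set c : ENNReal := ∑' i : ℕ+, ENNReal.ofReal ((2 * ((i : ℕ) : ℝ)) ^ (-2 : ℤ)) with hc
  have h : ∑' α : Word, ENNReal.ofReal (weight α ^ (-2 : ℤ)) = (1 - c)⁻¹ := by
    rw [← ENNReal.tsum_geometric]
    refine ((List.equivSigmaTuple (α := ℕ+)).symm.tsum_eq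
      (fun α : List ℕ+ => ENNReal.ofReal (weight (FreeMonoid.ofList α) ^ (-2 : ℤ)))).symm.trans ?_
    rw [ENNReal.tsum_sigma']
    refine tsum_congr fun n => ?_
    rw [hc, ← tsum_fin_prod]
    refine tsum_congr fun v => ?_
    change ENNReal.ofReal (weight (FreeMonoid.ofList (List.ofFn v)) ^ (-2 : ℤ)) = _
    rw [weight_ofFn, ← Finset.prod_zpow, ENNReal.ofReal_prod_of_nonneg fun i _ => by positivity]
  refine (ENNReal.summable_toReal (f := fun α : Word => ENNReal.ofReal (weight α ^ (-2 : ℤ)))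
    ?_).congr fun α => ENNReal.toReal_ofReal (zpow_nonneg (weight_pos α).le _)
  rw [h]
  exact ENNReal.inv_ne_top.2 (tsub_pos_of_lt letters_sum_lt_one).ne'

/-- For `f` in `L²(μ_{-p})`, the family `f_α (2ℕ)^{-α(p+2)/2}` is absolutely summable. -/
theorem summable_scaled {p : ℤ} {f : Word → ℂ} (hf : IsL2 (-p) f) :
    Summable fun α => ‖f α‖ * √(weight α) ^ (-(p + 2)) := by
  refine Summable.of_nonneg_of_le (scaled_nonneg _ f) (fun α => ?_)
    ((Summable.add hf summable_weight).mul_left (1 / 2))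
  have hw := Real.sqrt_pos.2 (weight_pos α)
  have h1 : √(weight α) ^ (-(p + 2)) = √(weight α) ^ (-p) * √(weight α) ^ (-2 : ℤ) := by
    rw [← zpow_add₀ hw.ne']
    congr 1
    ring
  have h2 := sq_nonneg (‖f α‖ * √(weight α) ^ (-p) - √(weight α) ^ (-2 : ℤ))
  rw [← sqrt_zpow_sq (-p), ← sqrt_zpow_sq (-2), h1]
  nlinarith

/-- The coefficients of distributions are stable under the Wick product. -/
theorem conv_mem {f g : Word → ℂ} (hf : f ∈ distSubmodule) (hg : g ∈ distSubmodule) :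
    conv f g ∈ distSubmodule := by
  obtain ⟨p, hf⟩ := hf
  obtain ⟨p', hg⟩ := hg
  set q : ℤ := ((max p p' : ℕ) : ℤ) with hq
  have hf1 : IsL2 (-q) f := IsL2.mono (by simp [hq]) hf
  have hg1 : IsL2 (-q) g := IsL2.mono (by simp [hq]) hg
  set F : Word → ℝ := fun α => ‖f α‖ * √(weight α) ^ (-(q + 2)) with hF
  set G : Word → ℝ := fun α => ‖g α‖ * √(weight α) ^ (-(q + 2)) with hG
  have hF0 : ∀ α, 0 ≤ F α := scaled_nonneg _ f
  have hG0 : ∀ α, 0 ≤ G α := scaled_nonneg _ g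
  have hFG : Summable fun x : Word × Word => F x.1 * G x.2 :=
    (summable_scaled hf1).mul_of_nonneg (summable_scaled hg1) hF0 hG0
  have hsig := ((Finset.HasMulAntidiagonal.sigmaMulAntidiagonalEquivProd (A := Word)).summable_iff.2 hFG).sigma
  have hle : ∀ α, ‖conv f g α‖ * √(weight α) ^ (-(q + 2)) ≤
      ∑' x : ↥(Finset.HasMulAntidiagonal.mulAntidiagonal α), F x.1.1 * G x.1.2 := fun α => by
    rw [Finset.tsum_subtype (Finset.HasMulAntidiagonal.mulAntidiagonal α)
      fun x : Word × Word => F x.1 * G x.2]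
    refine (mul_le_mul_of_nonneg_right (norm_sum_le _ _)
      (zpow_nonneg (Real.sqrt_nonneg _) _)).trans_eq ?_
    rw [Finset.sum_mul]
    refine Finset.sum_congr rfl fun x hx => ?_
    rw [Finset.HasMulAntidiagonal.mem_mulAntidiagonal] at hx
    rw [← hx, map_mul, Real.sqrt_mul (weight_pos _).le, mul_zpow, norm_mul]
    simp only [hF, hG]
    ring
  have hsum : Summable fun α => ‖conv f g α‖ * √(weight α) ^ (-(q + 2)) :=
    Summable.of_nonneg_of_le (scaled_nonneg _ _) hle hsig
  have hfin : IsL2 (-(q + 2)) (conv f g) := by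
    have := hsum.mul_of_nonneg hsum (scaled_nonneg _ _) (scaled_nonneg _ _)
    refine (this.comp_injective (i := fun α : Word => (α, α))
      fun a b h => (Prod.mk.inj h).1).congr fun α => ?_
    rw [← sqrt_zpow_sq]
    simp only [Function.comp]
    ring
  refine ⟨max p p' + 2, ?_⟩
  rw [hq] at hfin
  exact_mod_cast hfin

/-- The Wick product `f ⊗ g` of distributions. -/
def wick (f g : DistSpace) : DistSpace := ⟨conv f.coeff g.coeff, conv_mem f.2 g.2⟩

theorem wick_coeff (f g : DistSpace) : (wick f g).coeff = conv f.coeff g.coeff := rfl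

/-- Distributions form a ring under addition and the Wick product; its unit is the vacuum. -/
instance : Ring DistSpace :=
  { (inferInstance : AddCommGroup DistSpace) with
    mul := wick
    one := ⟨vacuum, vacuum_mem⟩
    mul_assoc := fun f g h => DistSpace.coeff_injective (conv_assoc _ _ _)
    one_mul := fun f => DistSpace.coeff_injective (vacuum_conv _)
    mul_one := fun f => DistSpace.coeff_injective (conv_vacuum _)
    left_distrib := fun f g h => DistSpace.coeff_injective (conv_add _ _ _)
    right_distrib := fun f g h => DistSpace.coeff_injective (add_conv _ _ _)
    zero_mul := fun f => DistSpace.coeff_injective (by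
      ext α
      change conv (0 : Word → ℂ) f.coeff α = 0
      simp [conv])
    mul_zero := fun f => DistSpace.coeff_injective (by
      ext α
      change conv f.coeff (0 : Word → ℂ) α = 0
      simp [conv]) }

instance : Algebra ℂ DistSpace :=
  Algebra.ofModule (fun c _ _ => DistSpace.coeff_injective (smul_conv c _ _))
    (fun c _ _ => DistSpace.coeff_injective (conv_smul c _ _))

theorem mul_eq_wick (f g : DistSpace) : f * g = wick f g := rfl

end NCKondratiev

end

/-!
The topology of the strong dual can be described by weighted `ℓ¹`-seminorms. Since
`∑_α (2ℕ)^{-2α}` converges, the pointwise supremum `r α = sup_{φ ∈ S} |φ_α|` over a bounded set `S`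
of test functions is still a rapidly decreasing family (`RapidDecay`), and conversely the set of
test functions dominated by such a family is bounded. Therefore the sets
`{f | ∑_α |f_α| r_α < 1}`, with `r` rapidly decreasing, form a basis of neighbourhoods of `0` in
`DistSpace` (`hasBasis_nhds_zero`).

For a rapidly decreasing `r` put `s β = √(sup {r α | weight β ≤ weight α})`. This family is again
rapidly decreasing, and since `weight (β γ)` dominates both `weight β` and `weight γ`, one has
`r (β γ) ≤ s β * s γ` (`RapidDecay.exists_submultiplicative`). It follows that
`∑ |(f ⊗ g)_α| r_α ≤ (∑ |f_β| s_β) (∑ |g_γ| s_γ)` (`weightedSum_wick_le`), which gives the joint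
continuity of the bilinear Wick product.
-/

noncomputable section

namespace NCKondratiev

open Filter Topology

/-! ### Rapidly decreasing families -/

/-- A family of nonnegative real numbers decreasing faster than every power of `(2ℕ)^α`. -/
structure RapidDecay (r : Word → ℝ) : Prop where
  nonneg : ∀ α, 0 ≤ r α
  bound : ∀ p : ℕ, ∃ C, ∀ α, r α * weight α ^ p ≤ C

theorem RapidDecay.smul {r : Word → ℝ} (hr : RapidDecay r) {c : ℝ} (hc : 0 ≤ c) :
    RapidDecay (c • r) where
  nonneg α := mul_nonneg hc (hr.nonneg α)
  bound p := by
    obtain ⟨C, hC⟩ := hr.bound p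
    refine ⟨c * C, fun α => ?_⟩
    rw [Pi.smul_apply, smul_eq_mul, mul_assoc]
    exact mul_le_mul_of_nonneg_left (hC α) hc

/-- A family dominated by a rapidly decreasing one is square summable for all the weights,
because `∑_α (2ℕ)^{-2α}` converges. -/
theorem RapidDecay.isL2 {r : Word → ℝ} (hr : RapidDecay r) {φ : Word → ℂ}
    (hφ : ∀ α, ‖φ α‖ ≤ r α) (p : ℕ) : IsL2 p φ := by
  obtain ⟨C, hC⟩ := hr.bound (p + 1)
  refine Summable.of_nonneg_of_le (term_nonneg _ φ) (fun α => ?_)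
    (summable_weight.mul_left (C ^ 2))
  have hw := weight_pos α
  have h1 : ‖φ α‖ * weight α ^ (p + 1) ≤ C :=
    (mul_le_mul_of_nonneg_right (hφ α) (by positivity)).trans (hC α)
  have h2 : (1 : ℝ) ≤ weight α ^ p := one_le_pow₀ (one_le_weight α)
  have h3 : (‖φ α‖ * weight α ^ (p + 1)) ^ 2 ≤ C ^ 2 := pow_le_pow_left₀ (by positivity) h1 2
  rw [zpow_natCast, zpow_neg, ← div_eq_mul_inv, le_div_iff₀ (by positivity)]
  refine le_trans ?_ h3
  have h4 : 0 ≤ ‖φ α‖ ^ 2 * (weight α ^ p * weight α ^ 2) := by positivity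
  have h5 : (weight α : ℝ) ^ (2 : ℤ) = weight α ^ 2 := zpow_ofNat _ _
  rw [h5]
  calc ‖φ α‖ ^ 2 * weight α ^ p * weight α ^ 2
      = ‖φ α‖ ^ 2 * (weight α ^ p * weight α ^ 2) * 1 := by ring
    _ ≤ ‖φ α‖ ^ 2 * (weight α ^ p * weight α ^ 2) * weight α ^ p :=
        mul_le_mul_of_nonneg_left h2 h4
    _ = (‖φ α‖ * weight α ^ (p + 1)) ^ 2 := by ring

/-- The test function with coefficients `φ`, for a family `φ` dominated by a rapidly decreasing
one. -/
def RapidDecay.toTest {r : Word → ℝ} (hr : RapidDecay r) (φ : Word → ℂ)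
    (hφ : ∀ α, ‖φ α‖ ≤ r α) : TestSpace :=
  ⟨φ, (Submodule.mem_iInf _).2 fun p => hr.isL2 hφ p⟩

theorem RapidDecay.toTest_coeff {r : Word → ℝ} (hr : RapidDecay r) (φ : Word → ℂ)
    (hφ : ∀ α, ‖φ α‖ ≤ r α) : (hr.toTest φ hφ).coeff = φ := rfl

theorem RapidDecay.norm_ofReal {r : Word → ℝ} (hr : RapidDecay r) (α : Word) :
    ‖((r α : ℝ) : ℂ)‖ = r α := by
  rw [Complex.norm_real, Real.norm_of_nonneg (hr.nonneg α)]

/-- Every rapidly decreasing family is dominated, along concatenation, by the tensor square of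
another one. -/
theorem RapidDecay.exists_submultiplicative {r : Word → ℝ} (hr : RapidDecay r) :
    ∃ s, RapidDecay s ∧ ∀ β γ, r (β * γ) ≤ s β * s γ := by
  -- `m` is the least majorant of `r` that is a decreasing function of the weight.
  set m : Word → ℝ := fun β => ⨆ α : {α // weight β ≤ weight α}, r α with hm
  have hm0 : ∀ β, 0 ≤ m β := fun β => Real.iSup_nonneg fun α => hr.nonneg α
  have hle : ∀ {α β}, weight β ≤ weight α → r α ≤ m β := fun {α β} h => by
    obtain ⟨C, hC⟩ := hr.bound 0
    refine le_ciSup (f := fun α : {α // weight β ≤ weight α} => r α) ⟨C, ?_⟩ ⟨α, h⟩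
    rintro _ ⟨a, rfl⟩
    simpa using hC a
  refine ⟨fun β => √(m β), ⟨fun β => Real.sqrt_nonneg _, fun p => ?_⟩, fun β γ => ?_⟩
  · obtain ⟨C, hC⟩ := hr.bound (2 * p)
    refine ⟨√C, fun β => ?_⟩
    have hw := weight_pos β
    refine Real.le_sqrt_of_sq_le ?_
    rw [mul_pow, Real.sq_sqrt (hm0 β), ← pow_mul, mul_comm p 2,
      Real.iSup_mul_of_nonneg (by positivity)]
    have : Nonempty {α // weight β ≤ weight α} := ⟨⟨β, le_rfl⟩⟩
    exact ciSup_le fun α => (mul_le_mul_of_nonneg_left (pow_le_pow_left₀ hw.le α.2 _)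
      (hr.nonneg α)).trans (hC α)
  · have h1 : r (β * γ) ≤ m β := hle (by
      rw [map_mul]; exact le_mul_of_one_le_right (weight_pos β).le (one_le_weight γ))
    have h2 : r (β * γ) ≤ m γ := hle (by
      rw [map_mul]; exact le_mul_of_one_le_left (weight_pos γ).le (one_le_weight β))
    rw [← Real.sqrt_mul (hm0 β)]
    refine Real.le_sqrt_of_sq_le ?_
    rw [sq]
    exact mul_le_mul h1 h2 (hr.nonneg _) (hm0 β)

/-! ### Bounded sets of test functions -/

theorem norm_coeff_mul_weight_le (φ : TestSpace) (p : ℕ) (α : Word) :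
    ‖φ.coeff α‖ * weight α ^ p ≤ testSeminorm (2 * p) φ := by
  rw [testSeminorm_apply, l2norm]
  refine Real.le_sqrt_of_sq_le ?_
  refine le_trans (le_of_eq ?_) ((φ.isL2 (2 * p)).le_tsum α fun β _ => term_nonneg _ _ β)
  rw [zpow_natCast]
  ring

/-- The pointwise supremum of a bounded set of test functions is rapidly decreasing. -/
theorem exists_rapidDecay_of_isVonNBounded {S : Set TestSpace} (hS : Bornology.IsVonNBounded ℂ S) :
    ∃ r, RapidDecay r ∧ ∀ φ ∈ S, ∀ α, ‖φ.coeff α‖ ≤ r α := by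
  rw [withSeminorms_test.isVonNBounded_iff_seminorm_bounded] at hS
  have hb : ∀ p : ℕ, ∃ C, 0 ≤ C ∧ ∀ φ ∈ S, ∀ α, ‖φ.coeff α‖ * weight α ^ p ≤ C := fun p => by
    obtain ⟨C, hC0, hC⟩ := hS (2 * p)
    exact ⟨C, hC0.le, fun φ hφ α => (norm_coeff_mul_weight_le φ p α).trans (hC φ hφ).le⟩
  refine ⟨fun α => ⨆ φ : S, ‖φ.1.coeff α‖, ⟨fun α => Real.iSup_nonneg fun φ => norm_nonneg _,
    fun p => ?_⟩, fun φ hφ α => ?_⟩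
  · obtain ⟨C, hC0, hC⟩ := hb p
    refine ⟨C, fun α => ?_⟩
    rw [Real.iSup_mul_of_nonneg (pow_nonneg (weight_pos α).le _)]
    exact Real.iSup_le (fun φ => hC φ.1 φ.2 α) hC0
  · obtain ⟨C, -, hC⟩ := hb 0
    refine le_ciSup (f := fun φ : S => ‖φ.1.coeff α‖) ⟨C, ?_⟩ ⟨φ, hφ⟩
    rintro _ ⟨ψ, rfl⟩
    simpa using hC ψ.1 ψ.2 α

theorem RapidDecay.isVonNBounded {r : Word → ℝ} (hr : RapidDecay r) :
    Bornology.IsVonNBounded ℂ {φ : TestSpace | ∀ α, ‖φ.coeff α‖ ≤ r α} := by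
  rw [withSeminorms_test.isVonNBounded_iff_seminorm_bounded]
  intro p
  have hr2 : IsL2 p (fun α => (r α : ℂ)) := hr.isL2 (fun α => (hr.norm_ofReal α).le) p
  refine ⟨l2norm p (fun α => (r α : ℂ)) + 1, by linarith [l2norm_nonneg p fun α => (r α : ℂ)],
    fun φ hφ => lt_of_le_of_lt ?_ (lt_add_one _)⟩
  refine Real.sqrt_le_sqrt ((φ.isL2 p).tsum_le_tsum (fun α => ?_) hr2)
  rw [hr.norm_ofReal]
  exact mul_le_mul_of_nonneg_right (pow_le_pow_left₀ (norm_nonneg _) (hφ α) 2)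
    (zpow_nonneg (weight_pos α).le _)

/-! ### Weighted sums of distributions -/

/-- The weighted `ℓ¹`-seminorm `∑_α |f_α| r_α` of a distribution `f`. -/
def weightedSum (r : Word → ℝ) (f : DistSpace) : ℝ := ∑' α, ‖f.coeff α‖ * r α

theorem RapidDecay.summable {r : Word → ℝ} (hr : RapidDecay r) (f : DistSpace) :
    Summable fun α => ‖f.coeff α‖ * r α := by
  obtain ⟨p, hp⟩ := f.isL2
  refine (pairing_aux hp (hr.isL2 (fun α => (hr.norm_ofReal α).le) p)).1.norm.congr fun α => ?_
  rw [norm_mul, hr.norm_ofReal]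

theorem RapidDecay.weightedSum_nonneg {r : Word → ℝ} (hr : RapidDecay r) (f : DistSpace) :
    0 ≤ weightedSum r f := tsum_nonneg fun α => mul_nonneg (norm_nonneg _) (hr.nonneg α)

theorem weightedSum_smul (c : ℝ) (r : Word → ℝ) (f : DistSpace) :
    weightedSum (c • r) f = c * weightedSum r f := by
  simp only [weightedSum, ← tsum_mul_left, Pi.smul_apply, smul_eq_mul]
  exact tsum_congr fun α => by ring

theorem norm_dualEquiv_le {r : Word → ℝ} (hr : RapidDecay r) (f : DistSpace) {φ : TestSpace}
    (hφ : ∀ α, ‖φ.coeff α‖ ≤ r α) : ‖dualEquiv f φ‖ ≤ weightedSum r f := by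
  rw [dualEquiv_apply]
  refine tsum_of_norm_bounded (hr.summable f).hasSum fun α => ?_
  rw [norm_mul]
  exact mul_le_mul_of_nonneg_left (hφ α) (norm_nonneg _)

/-- The weighted sum is attained as the pairing with a test function dominated by the weight. -/
theorem exists_dualEquiv_eq_weightedSum {r : Word → ℝ} (hr : RapidDecay r) (f : DistSpace) :
    ∃ φ : TestSpace, (∀ α, ‖φ.coeff α‖ ≤ r α) ∧ dualEquiv f φ = weightedSum r f := by
  -- At a zero of `f` the quotient below is `0`, which is harmless.
  set φ : Word → ℂ := fun α => (r α : ℂ) * ((starRingEnd ℂ) (f.coeff α) / ‖f.coeff α‖) with hφdef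
  have hφ : ∀ α, ‖φ α‖ ≤ r α := fun α => by
    rw [hφdef]
    simp only [norm_mul, norm_div, RCLike.norm_conj, hr.norm_ofReal, Complex.norm_real, norm_norm]
    exact mul_le_of_le_one_right (hr.nonneg α) (div_self_le_one _)
  refine ⟨hr.toTest φ hφ, hφ, ?_⟩
  rw [dualEquiv_apply, weightedSum, Complex.ofReal_tsum]
  refine tsum_congr fun α => ?_
  rw [hr.toTest_coeff, hφdef]
  by_cases h : f.coeff α = 0
  · simp [h]
  · have h' : (‖f.coeff α‖ : ℂ) ≠ 0 := by simpa using h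
    have h2 := Complex.mul_conj' (f.coeff α)
    push_cast
    field_simp
    linear_combination (r α : ℂ) * h2

/-- Neighbourhoods of zero for the strong topology, in terms of weighted `ℓ¹`-seminorms. The radius
`1` is no restriction, because the weight may be rescaled. -/
theorem hasBasis_nhds_zero :
    (𝓝 (0 : DistSpace)).HasBasis RapidDecay fun r => {f | weightedSum r f < 1} := by
  have h0 : 𝓝 (0 : DistSpace) = comap dualEquiv (𝓝 (0 : StrongDual ℂ TestSpace)) := by
    rw [nhds_induced, map_zero]
  have hB := (ContinuousLinearMap.hasBasis_nhds_zero (σ := RingHom.id ℂ) (E := TestSpace)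
    (F := ℂ)).comap dualEquiv
  rw [← h0] at hB
  refine hB.to_hasBasis ?_ ?_
  · rintro ⟨S, V⟩ ⟨hS, hV⟩
    obtain ⟨ε, hε, hεV⟩ := Metric.mem_nhds_iff.1 hV
    obtain ⟨r, hr, hrS⟩ := exists_rapidDecay_of_isVonNBounded hS
    refine ⟨ε⁻¹ • r, hr.smul (inv_pos.2 hε).le, fun f hf φ hφ => hεV ?_⟩
    change weightedSum _ f < 1 at hf
    rw [weightedSum_smul, inv_mul_lt_iff₀ hε, mul_one] at hf
    rw [mem_ball_zero_iff]
    exact (norm_dualEquiv_le hr f (hrS φ hφ)).trans_lt hf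
  · intro r hr
    refine ⟨({φ | ∀ α, ‖φ.coeff α‖ ≤ r α}, Metric.ball 0 1),
      ⟨hr.isVonNBounded, Metric.ball_mem_nhds _ one_pos⟩, fun f hf => ?_⟩
    obtain ⟨φ, hφ, he⟩ := exists_dualEquiv_eq_weightedSum hr f
    have h : dualEquiv f φ ∈ Metric.ball (0 : ℂ) 1 := hf φ hφ
    rw [mem_ball_zero_iff, he, Complex.norm_real,
      Real.norm_of_nonneg (hr.weightedSum_nonneg f)] at h
    exact h

theorem RapidDecay.tendsto_weightedSum {r : Word → ℝ} (hr : RapidDecay r) :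
    Tendsto (weightedSum r) (𝓝 0) (𝓝 0) := by
  refine tendsto_order.2 ⟨fun a ha => Eventually.of_forall fun f =>
    ha.trans_le (hr.weightedSum_nonneg f), fun a ha => ?_⟩
  filter_upwards [hasBasis_nhds_zero.mem_of_mem (hr.smul (inv_pos.2 ha).le)] with f hf
  rwa [weightedSum_smul, inv_mul_lt_iff₀ ha, mul_one] at hf

theorem tendsto_nhds_zero_iff {ι : Type*} {l : Filter ι} {F : ι → DistSpace} :
    Tendsto F l (𝓝 0) ↔ ∀ r, RapidDecay r → Tendsto (fun i => weightedSum r (F i)) l (𝓝 0) :=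
  ⟨fun h _ hr => hr.tendsto_weightedSum.comp h, fun h =>
    hasBasis_nhds_zero.tendsto_right_iff.2 fun r hr => (h r hr).eventually (gt_mem_nhds one_pos)⟩

/-! ### Continuity of the Wick product -/

theorem weightedSum_wick_le {r s : Word → ℝ} (hr : RapidDecay r) (hs : RapidDecay s)
    (hrs : ∀ β γ, r (β * γ) ≤ s β * s γ) (f g : DistSpace) :
    weightedSum r (wick f g) ≤ weightedSum s f * weightedSum s g := by
  set F : Word → ℝ := fun α => ‖f.coeff α‖ * s α with hF
  set G : Word → ℝ := fun α => ‖g.coeff α‖ * s α with hG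
  have hFG : Summable fun x : Word × Word => F x.1 * G x.2 :=
    (hs.summable f).mul_of_nonneg (hs.summable g)
      (fun α => mul_nonneg (norm_nonneg _) (hs.nonneg α))
      (fun α => mul_nonneg (norm_nonneg _) (hs.nonneg α))
  set e := Finset.HasMulAntidiagonal.sigmaMulAntidiagonalEquivProd (A := Word)
  have hsig : Summable ((fun x : Word × Word => F x.1 * G x.2) ∘ e) := e.summable_iff.2 hFG
  have hle : ∀ α, ‖(wick f g).coeff α‖ * r α ≤
      ∑' x : ↥(Finset.HasMulAntidiagonal.mulAntidiagonal α), F x.1.1 * G x.1.2 := fun α => by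
    rw [Finset.tsum_subtype (Finset.HasMulAntidiagonal.mulAntidiagonal α)
      fun x : Word × Word => F x.1 * G x.2, wick_coeff]
    refine (mul_le_mul_of_nonneg_right (norm_sum_le _ _) (hr.nonneg α)).trans ?_
    rw [Finset.sum_mul]
    refine Finset.sum_le_sum fun x hx => ?_
    rw [Finset.HasMulAntidiagonal.mem_mulAntidiagonal] at hx
    rw [← hx, norm_mul]
    refine (mul_le_mul_of_nonneg_left (hrs x.1 x.2) (by positivity)).trans_eq ?_
    simp only [hF, hG]
    ring
  calc weightedSum r (wick f g)
      ≤ ∑' α, ∑' x : ↥(Finset.HasMulAntidiagonal.mulAntidiagonal α), F x.1.1 * G x.1.2 :=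
        (hr.summable _).tsum_le_tsum hle hsig.sigma
    _ = ∑' y, ((fun x : Word × Word => F x.1 * G x.2) ∘ e) y := hsig.tsum_sigma.symm
    _ = ∑' x : Word × Word, F x.1 * G x.2 :=
        e.tsum_eq fun x : Word × Word => F x.1 * G x.2
    _ = weightedSum s f * weightedSum s g :=
        ((hs.summable f).tsum_mul_tsum (hs.summable g) hFG).symm

/-- A Wick product tends to zero as soon as, for every rapidly decreasing weight, the product of the
weighted sums of its factors does. -/
theorem tendsto_mul_zero {ι : Type*} {l : Filter ι} {F G : ι → DistSpace}
    (h : ∀ s, RapidDecay s →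
      Tendsto (fun i => weightedSum s (F i) * weightedSum s (G i)) l (𝓝 0)) :
    Tendsto (fun i => F i * G i) l (𝓝 0) := by
  refine tendsto_nhds_zero_iff.2 fun r hr => ?_
  obtain ⟨s, hs, hrs⟩ := hr.exists_submultiplicative
  exact squeeze_zero (fun i => hr.weightedSum_nonneg _)
    (fun i => weightedSum_wick_le hr hs hrs (F i) (G i)) (h s hs)

instance : IsTopologicalAddGroup DistSpace := topologicalAddGroup_induced dualEquiv

instance : ContinuousSMul ℂ DistSpace := continuousSMul_induced dualEquiv

instance : IsTopologicalRing DistSpace := by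
  refine IsTopologicalRing.of_addGroup_of_nhds_zero ?_ (fun f => ?_) (fun g => ?_)
  · refine tendsto_mul_zero fun s hs => ?_
    simpa using (hs.tendsto_weightedSum.comp tendsto_fst).mul
      (hs.tendsto_weightedSum.comp tendsto_snd)
  · refine tendsto_mul_zero fun s hs => ?_
    simpa using hs.tendsto_weightedSum.const_mul (weightedSum s f)
  · refine tendsto_mul_zero fun s hs => ?_
    simpa using hs.tendsto_weightedSum.mul_const (weightedSum s g)

end NCKondratiev

end

theorem mainTheorem4 :
    Continuous (fun x : NCKondratiev.DistSpace × NCKondratiev.DistSpace =>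
      NCKondratiev.wick x.1 x.2) ∧
    IsTopologicalRing NCKondratiev.DistSpace ∧
    ContinuousSMul ℂ NCKondratiev.DistSpace :=
  ⟨continuous_mul (M := NCKondratiev.DistSpace), inferInstance, inferInstance⟩
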